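/- Let $\mathcal S_n$ be the set of permutations of $\{1,\dots,n\}$ and $\mathcal S=\bigcup_{n\ge 0}\mathcal S_n$; write $|\pi|=n$ for $\pi\in\mathcal S_n$. For $\pi\in\mathcal S_n$ let $c_{\underline{123}}(\pi)$ be the number of $i$ with $1\le i\le n-2$ and $\pi(i)<\pi(i+1)<\pi(i+2)$, let $\mathrm{asc}(\pi)$ be the number of $i$ with $1\le i\le n-1$ and $\pi(i)<\pi(i+1)$, and let $\mathrm{lrmin}(\pi)$ be the number of $i$ with $\pi(i)<\pi(j)$ for all $j<i$. Let $\mathrm{exc}(\pi)$ be the number of values $\pi(i)$ with $i<\pi(i)$ (excedances), $\mathrm{dexc}(\pi)$ the number of values $\pi(i)$ with $i<\pi(i)<\pi(\pi(i))$ (double excedances), and $\mathrm{cyc}(\pi)$ the number of cycles of $\pi$, fixed points included. Let $\hat\pi$ be the permutation whose one-line notation is obtained by writing each cycle of $\pi$ with its smallest element first, ordering the cycles by decreasing smallest element, and removing the parentheses. For sequences $d=(d_1,d_2,\dots)$ and $\ell=(\ell_0,\ell_1,\dots)$ in a commutative ring, let $$J_{d,\ell}(z)=\cfrac{1}{1-\ell_0z-\cfrac{d_1z^2}{1-\ell_1z-\cfrac{d_2z^2}{1-\ell_2z-\cdots}}}$$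 be the formal power series that is the coefficientwise limit of the finite truncations of this continued fraction. Then, for all elements $v,w,t$ of a commutative ring (in particular for indeterminates), the following hold. 1. $\displaystyle\sum_{\pi\in\mathcal S} w^{c_{\underline{123}}(\pi)}z^{|\pi|}=J_{d,\ell}(z)$ with $d_h=h^2$ and $\ell_h=(h+1)+hw$. 2. $\displaystyle\sum_{\pi\in\mathcal S} v^{\mathrm{asc}(\pi)}w^{c_{\underline{123}}(\pi)}t^{\mathrm{lrmin}(\pi)}z^{|\pi|}=J_{d,\ell}(z)$ with $d_h=vh(h-1+t)$ and $\ell_h=t+h(1+vw)$. 3. For every $n\ge 0$, the map $\pi\mapsto\hat\pi$ is a bijection from $\mathcal S_n$ to itself, and for every $\pi\in\mathcal S_n$: - $c_{\underline{123}}(\hat\pi)=\mathrm{dexc}(\pi)$; more precisely, the triples $(\hat\pi(i),\hat\pi(i+1),\hat\pi(i+2))$ with $\hat\pi(i)<\hat\pi(i+1)<\hat\pi(i+2)$ are exactly the triples $(a,\pi(a),\pi(\pi(a)))$ with $a<\pi(a)<\pi(\pi(a))$; - $\mathrm{asc}(\hat\pi)=\mathrm{exc}(\pi)$; more precisely, the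 pairs $(\hat\pi(i),\hat\pi(i+1))$ with $\hat\pi(i)<\hat\pi(i+1)$ are exactly the pairs $(a,\pi(a))$ with $a<\pi(a)$; - $\mathrm{lrmin}(\hat\pi)=\mathrm{cyc}(\pi)$; more precisely, $\hat\pi(i)$ is a left-to-right minimum of $\hat\pi$ if and only if it is the smallest element of its cycle in $\pi$. -/

import Mathlib

namespace PermStat

open Equiv

variable {n : ℕ}

/-! Permutations of `{1, …, n}` are modelled as `Perm (Fin n)` (all entries shifted by one). -/

/-- Positions `i` at which an occurrence `π(i) < π(i+1) < π(i+2)` of the consecutive pattern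
`123` starts. -/
def occ123 (π : Perm (Fin n)) : Finset (Fin n) :=
  Finset.univ.filter fun i =>
    ∃ j k : Fin n, (j : ℕ) = i + 1 ∧ (k : ℕ) = i + 2 ∧ π i < π j ∧ π j < π k

/-- Ascent positions: `i` with `π(i) < π(i+1)`. -/
def ascents (π : Perm (Fin n)) : Finset (Fin n) :=
  Finset.univ.filter fun i => ∃ j : Fin n, (j : ℕ) = i + 1 ∧ π i < π j

/-- Positions of left-to-right minima: `i` with `π(i) < π(j)` for all `j < i`. -/
def lrMinima (π : Perm (Fin n)) : Finset (Fin n) :=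
  Finset.univ.filter fun i => ∀ j : Fin n, j < i → π i < π j

/-- The excedance values: values `π(i)` with `i < π(i)`. -/
def excedances (π : Perm (Fin n)) : Finset (Fin n) :=
  (Finset.univ.filter fun i => i < π i).image π

/-- The double excedance values: values `π(i)` with `i < π(i) < π(π(i))`. -/
def doubleExcedances (π : Perm (Fin n)) : Finset (Fin n) :=
  (Finset.univ.filter fun i => i < π i ∧ π i < π (π i)).image π

/-- Number of cycles of `π`, fixed points included. -/
noncomputable def cycleCount (π : Perm (Fin n)) : ℕ :=
  Nat.card (Quotient (Perm.SameCycle.setoid π))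

/-- `m` is the smallest element of its cycle. -/
def IsCycleMin (π : Perm (Fin n)) (m : Fin n) : Prop :=
  ∀ j : Fin n, π.SameCycle m j → m ≤ j

instance (π : Perm (Fin n)) : DecidablePred (IsCycleMin π) := fun m =>
  inferInstanceAs (Decidable (∀ j : Fin n, π.SameCycle m j → m ≤ j))

/-- The cycle of `π` through `m`, written starting at `m`: `m, π(m), π(π(m)), …`. -/
def cycleWord (π : Perm (Fin n)) (m : Fin n) : List (Fin n) :=
  List.iterate π m (Finset.univ.filter fun j => π.SameCycle m j).card

/-- The smallest elements of the cycles of `π`, in decreasing order. -/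
def cycleMinima (π : Perm (Fin n)) : List (Fin n) :=
  ((List.finRange n).filter fun m => IsCycleMin π m).reverse

/-- The cycles of `π`, each written with its smallest element first, sorted by decreasing
smallest element, and concatenated (parentheses removed). -/
def foataWord (π : Perm (Fin n)) : List (Fin n) :=
  (cycleMinima π).flatMap (cycleWord π)

theorem sameCycle_iff_iterate (π : Perm (Fin n)) (m j : Fin n) :
    π.SameCycle m j ↔ ∃ k < Function.minimalPeriod π m, j = π^[k] m := by
  constructor
  · intro h
    obtain ⟨k, -, hk⟩ := h.exists_pow_eq'
    refine ⟨k % Function.minimalPeriod π m, Nat.mod_lt _ ?_, ?_⟩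
    · exact Function.minimalPeriod_pos_of_mem_periodicPts
        (π.injective.mem_periodicPts m)
    · rw [Function.iterate_mod_minimalPeriod_eq, ← hk, Perm.iterate_eq_pow]
  · rintro ⟨k, -, rfl⟩
    rw [Perm.iterate_eq_pow]
    exact ⟨k, by simp⟩

theorem card_sameCycle (π : Perm (Fin n)) (m : Fin n) :
    (Finset.univ.filter fun j => π.SameCycle m j).card = Function.minimalPeriod π m := by
  have h : (Finset.univ.filter fun j => π.SameCycle m j) =
      (Finset.range (Function.minimalPeriod π m)).image fun k => π^[k] m := by
    ext j
    simp only [Finset.mem_filter, Finset.mem_univ, true_and, sameCycle_iff_iterate,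
      Finset.mem_image, Finset.mem_range, eq_comm]
  rw [h, Finset.card_image_of_injOn, Finset.card_range]
  simpa using Function.iterate_injOn_Iio_minimalPeriod (f := π) (x := m)

theorem nodup_cycleWord (π : Perm (Fin n)) (m : Fin n) : (cycleWord π m).Nodup := by
  rw [cycleWord, card_sameCycle, ← List.range_map_iterate]
  refine List.Nodup.map_on ?_ List.nodup_range
  intro a ha b hb hab
  exact Function.iterate_injOn_Iio_minimalPeriod (List.mem_range.1 ha) (List.mem_range.1 hb) hab

theorem mem_cycleWord (π : Perm (Fin n)) (m j : Fin n) :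
    j ∈ cycleWord π m ↔ π.SameCycle m j := by
  rw [cycleWord, card_sameCycle, List.mem_iterate, sameCycle_iff_iterate]

theorem mem_cycleMinima (π : Perm (Fin n)) (m : Fin n) :
    m ∈ cycleMinima π ↔ IsCycleMin π m := by
  simp [cycleMinima]

theorem nodup_foataWord (π : Perm (Fin n)) : (foataWord π).Nodup := by
  rw [foataWord, List.nodup_flatMap]
  refine ⟨fun m _ => nodup_cycleWord π m, ?_⟩
  have hnd : (cycleMinima π).Nodup :=
    List.nodup_reverse.2 ((List.nodup_finRange n).filter _)
  refine List.Pairwise.imp_of_mem ?_ hnd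
  intro a b ha hb hab j hja hjb
  rw [mem_cycleMinima] at ha hb
  rw [mem_cycleWord] at hja hjb
  exact hab (le_antisymm (ha b (hja.trans hjb.symm)) (hb a (hjb.trans hja.symm)))

theorem mem_foataWord (π : Perm (Fin n)) (j : Fin n) : j ∈ foataWord π := by
  obtain ⟨m, hm, hmin⟩ := Finset.exists_min_image
    (Finset.univ.filter fun i => π.SameCycle j i) id ⟨j, by simp [Perm.SameCycle.refl]⟩
  simp only [Finset.mem_filter, Finset.mem_univ, true_and, id] at hm hmin
  refine List.mem_flatMap.2 ⟨m, (mem_cycleMinima π m).2 fun i hi => hmin i (hm.trans hi), ?_⟩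
  exact (mem_cycleWord π m j).2 hm.symm

theorem length_foataWord (π : Perm (Fin n)) : (foataWord π).length = n := by
  rw [← List.toFinset_card_of_nodup (nodup_foataWord π),
    Finset.eq_univ_iff_forall.2 fun j => List.mem_toFinset.2 (mem_foataWord π j),
    Finset.card_univ, Fintype.card_fin]

/-- The permutation `π̂` whose one-line notation `π̂(1) π̂(2) … π̂(n)` is `foataWord π`. -/
def foataHat (π : Perm (Fin n)) : Perm (Fin n) :=
  (finCongr (length_foataWord π).symm).trans
    ((nodup_foataWord π).getEquivOfForallMemList _ (mem_foataWord π))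

end PermStat

namespace JFrac

open PowerSeries

variable {R : Type*} [CommRing R]

/-- The finite continued fraction of depth `N` starting at level `h`,
`1 / (1 - ℓ_h z - d_{h+1} z² / (1 - ℓ_{h+1} z - ⋯ d_{h+N} z² / (1 - ℓ_{h+N} z)))`,
as a formal power series (every denominator has constant coefficient `1`, so that
`invOfUnit _ 1` is its inverse). -/
noncomputable def convergentFrom (d l : ℕ → R) : ℕ → ℕ → R⟦X⟧
  | h, 0 => invOfUnit (1 - C (l h) * X) 1
  | h, N + 1 => invOfUnit
      (1 - C (l h) * X - C (d (h + 1)) * X ^ 2 * convergentFrom d l (h + 1) N) 1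

/-- `F` is the J-fraction with coefficients `d = (d₁, d₂, …)` and `ℓ = (ℓ₀, ℓ₁, …)`: its
convergents converge to `F` as formal power series, i.e. each coefficient is eventually
that of `F`. The value `d 0` plays no role. -/
def IsJFraction (F : R⟦X⟧) (d l : ℕ → R) : Prop :=
  ∀ n : ℕ, ∀ᶠ N in Filter.atTop, coeff n (convergentFrom d l 0 N) = coeff n F

end JFrac

/-! Two neighbours in the word of `π̂` are `a, π a` unless the second one starts a cycle, and the
minimum of a prefix of the word is the smallest element of the cycle where the prefix ends. So the
left-to-right minima of `π̂` mark the cycles, which makes `π` recoverable from `π̂`, and every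
ascent lies inside a cycle. The generating function thus counts permutations by excedances, double
excedances and cycles.

To enumerate these, build a permutation by inserting `1, 2, …, n` successively into its cycles,
leaving open the arcs into which larger elements will still be inserted. If `Pₙ` has as its
coefficient of `X ^ h` the weight of the configurations with `h` open arcs, then inserting the next
element into an arc replaces an open arc by a peak, with its two arcs open or not. Hence insertion
acts as a derivation, and `Pₙ₊₁ = t (1 + X) Pₙ + (v + (1 + v w) X + X²) Pₙ'`. On coefficients this
is a tridiagonal recurrence, and the constant coefficients of the solution of such a recurrence are
those of a J-fraction. -/

namespace PermStat

open Equiv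

variable {n : ℕ}

/-- The smallest element of the cycle of `π` through `a`. -/
def cycleMin (π : Perm (Fin n)) (a : Fin n) : Fin n :=
  (Finset.univ.filter fun j => π.SameCycle a j).min' ⟨a, by simp [Perm.SameCycle.rfl]⟩

theorem sameCycle_cycleMin (π : Perm (Fin n)) (a : Fin n) : π.SameCycle a (cycleMin π a) :=
  (Finset.mem_filter.1 (Finset.min'_mem _ _)).2

theorem cycleMin_le (π : Perm (Fin n)) (a : Fin n) : cycleMin π a ≤ a :=
  Finset.min'_le _ _ (by simp [Perm.SameCycle.rfl])

theorem cycleMin_eq_of_sameCycle {π : Perm (Fin n)} {a b : Fin n} (h : π.SameCycle a b) :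
    cycleMin π a = cycleMin π b := by
  have (j : Fin n) : π.SameCycle a j ↔ π.SameCycle b j := ⟨h.symm.trans, h.trans⟩
  simp only [cycleMin, this]

theorem cycleMin_apply (π : Perm (Fin n)) (a : Fin n) : cycleMin π (π a) = cycleMin π a :=
  cycleMin_eq_of_sameCycle (Perm.sameCycle_apply_left.2 .rfl)

theorem isCycleMin_iff {π : Perm (Fin n)} {a : Fin n} : IsCycleMin π a ↔ cycleMin π a = a := by
  refine ⟨fun h => (cycleMin_le π a).antisymm (h _ (sameCycle_cycleMin π a)), fun h j hj => ?_⟩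
  rw [← h, cycleMin_eq_of_sameCycle hj]
  exact cycleMin_le π j

theorem isCycleMin_cycleMin (π : Perm (Fin n)) (a : Fin n) : IsCycleMin π (cycleMin π a) :=
  isCycleMin_iff.2 (cycleMin_eq_of_sameCycle (sameCycle_cycleMin π a).symm)

theorem cycleCount_eq_card_filter_isCycleMin (π : Perm (Fin n)) :
    cycleCount π = (Finset.univ.filter (IsCycleMin π)).card := by
  rw [← Fintype.card_subtype, ← Nat.card_eq_fintype_card, cycleCount]
  refine (Nat.card_eq_of_bijective
    (fun m : {m // IsCycleMin π m} => Quotient.mk (Perm.SameCycle.setoid π) m) ⟨?_, ?_⟩).symm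
  · rintro ⟨a, ha⟩ ⟨b, hb⟩ h
    have h : π.SameCycle a b := Quotient.exact h
    exact Subtype.ext ((ha b h).antisymm (hb a h.symm))
  · rintro ⟨a⟩
    exact ⟨⟨cycleMin π a, isCycleMin_cycleMin π a⟩, Quotient.sound (sameCycle_cycleMin π a).symm⟩

theorem cycleWord_eq_cons (π : Perm (Fin n)) (m : Fin n) : ∃ l, cycleWord π m = m :: l := by
  have hpos : 0 < (Finset.univ.filter fun j => π.SameCycle m j).card :=
    Finset.card_pos.2 ⟨m, by simp [Perm.SameCycle.rfl]⟩
  obtain ⟨k, hk⟩ := Nat.exists_eq_add_one.2 hpos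
  exact ⟨_, by rw [cycleWord, hk, List.iterate]⟩

theorem pair_apply_infix_cycleWord {π : Perm (Fin n)} {m a : Fin n} (ha : π.SameCycle m a)
    (hm : π a ≠ m) : [a, π a] <:+: cycleWord π m := by
  obtain ⟨k, hk, rfl⟩ := (sameCycle_iff_iterate π m a).1 ha
  have hk' : k + 1 ≠ Function.minimalPeriod π m := by
    intro h
    rw [← Function.iterate_succ_apply' π, Nat.succ_eq_add_one, h] at hm
    exact hm Function.iterate_minimalPeriod
  obtain ⟨r, hr⟩ := Nat.exists_eq_add_of_le (show k + 2 ≤ Function.minimalPeriod π m by lia)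
  rw [cycleWord, card_sameCycle, hr, add_assoc, add_comm 2 r, List.iterate_add]
  exact ⟨_, _, List.append_assoc _ _ _⟩

theorem pair_apply_infix_foataWord {π : Perm (Fin n)} {a : Fin n} (h : ¬IsCycleMin π (π a)) :
    [a, π a] <:+: foataWord π := by
  have hm : π a ≠ cycleMin π a := fun h' => h (h' ▸ isCycleMin_cycleMin π a)
  exact (pair_apply_infix_cycleWord (sameCycle_cycleMin π a).symm hm).trans
    (List.infix_flatMap_of_mem ((mem_cycleMinima π _).2 (isCycleMin_cycleMin π a)) _)

theorem pairwise_gt_cycleMinima (π : Perm (Fin n)) : (cycleMinima π).Pairwise (· > ·) := by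
  rw [cycleMinima, List.pairwise_reverse]
  exact (List.pairwise_lt_finRange n).filter _

theorem pairwise_foataWord (π : Perm (Fin n)) :
    (foataWord π).Pairwise fun a b => cycleMin π b ≤ cycleMin π a ∧ cycleMin π a ≠ b := by
  have hmin {m x : Fin n} (hm : m ∈ cycleMinima π) (hx : x ∈ cycleWord π m) :
      cycleMin π x = m := by
    rw [← cycleMin_eq_of_sameCycle ((mem_cycleWord π m x).1 hx)]
    exact isCycleMin_iff.1 ((mem_cycleMinima π m).1 hm)
  rw [foataWord, List.pairwise_flatMap]
  refine ⟨fun m hm => ?_, ?_⟩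
  · obtain ⟨l, hl⟩ := cycleWord_eq_cons π m
    have hml : m ∉ l := (List.nodup_cons.1 (hl ▸ nodup_cycleWord π m)).1
    have hne : (cycleWord π m).Pairwise fun _ b => m ≠ b := by
      rw [hl, List.pairwise_cons]
      exact ⟨fun b hb => (ne_of_mem_of_not_mem hb hml).symm, List.pairwise_of_forall_mem_list
        fun _ _ b hb => (ne_of_mem_of_not_mem hb hml).symm⟩
    refine hne.imp_of_mem fun {a b} ha hb hmb => ?_
    rw [hmin hm ha, hmin hm hb]
    exact ⟨le_rfl, hmb⟩
  · refine (pairwise_gt_cycleMinima π).imp_of_mem fun {m m'} hm hm' hlt x hx y hy => ?_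
    rw [hmin hm hx, hmin hm' hy]
    refine ⟨hlt.le, ?_⟩
    rintro rfl
    exact hlt.ne' ((isCycleMin_iff.1 ((mem_cycleMinima π m).1 hm)).symm.trans (hmin hm' hy))

theorem cycleMin_foataHat_of_lt (π : Perm (Fin n)) {i j : Fin n} (hij : i < j) :
    cycleMin π (foataHat π j) ≤ cycleMin π (foataHat π i) ∧
      cycleMin π (foataHat π i) ≠ foataHat π j :=
  List.pairwise_iff_getElem.1 (pairwise_foataWord π) i j _ _ hij

theorem isLeast_image_foataHat_Iic (π : Perm (Fin n)) (i : Fin n) :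
    IsLeast (foataHat π '' Set.Iic i) (cycleMin π (foataHat π i)) := by
  constructor
  · obtain ⟨j, hj⟩ := (foataHat π).surjective (cycleMin π (foataHat π i))
    refine ⟨j, Set.mem_Iic.2 (le_of_not_gt fun hij => ?_), hj⟩
    exact (cycleMin_foataHat_of_lt π hij).2 hj.symm
  · rintro _ ⟨k, hk, rfl⟩
    obtain rfl | hki := eq_or_lt_of_le (Set.mem_Iic.1 hk)
    · exact cycleMin_le π _
    · exact (cycleMin_foataHat_of_lt π hki).1.trans (cycleMin_le π _)

theorem mem_lrMinima {σ : Perm (Fin n)} {i : Fin n} :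
    i ∈ lrMinima σ ↔ ∀ j < i, σ i < σ j := by
  simp [lrMinima]

theorem mem_lrMinima_iff_isLeast {σ : Perm (Fin n)} {i : Fin n} :
    i ∈ lrMinima σ ↔ IsLeast (σ '' Set.Iic i) (σ i) := by
  simp only [mem_lrMinima, IsLeast, Set.mem_image_of_mem σ Set.self_mem_Iic, true_and,
    mem_lowerBounds, Set.forall_mem_image, Set.mem_Iic]
  refine ⟨fun h j hj => ?_, fun h j hj => (h hj.le).lt_of_ne (σ.injective.ne hj.ne')⟩
  obtain rfl | hj := hj.eq_or_lt
  exacts [le_rfl, (h j hj).le]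

theorem mem_lrMinima_foataHat (π : Perm (Fin n)) (i : Fin n) :
    i ∈ lrMinima (foataHat π) ↔ IsCycleMin π (foataHat π i) := by
  rw [mem_lrMinima_iff_isLeast, isCycleMin_iff]
  have h := isLeast_image_foataHat_Iic π i
  exact ⟨h.unique, fun hi => hi ▸ h⟩

theorem exists_succ_foataHat_eq_apply {π : Perm (Fin n)} {i : Fin n}
    (h : ¬IsCycleMin π (π (foataHat π i))) :
    ∃ j : Fin n, (j : ℕ) = i + 1 ∧ foataHat π j = π (foataHat π i) := by
  obtain ⟨s, u, hsu⟩ := pair_apply_infix_foataWord h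
  have hlen : s.length + 1 < n := by
    have hlen := congrArg List.length hsu
    simp only [length_foataWord, List.length_append, List.length_cons, List.length_nil] at hlen
    lia
  have hget (k : ℕ) (hk : k < n) : (s ++ [foataHat π i, π (foataHat π i)] ++ u)[k]? =
      some (foataHat π ⟨k, hk⟩) := by
    rw [hsu]
    exact List.getElem?_eq_getElem _
  have hi : i = ⟨s.length, by lia⟩ := (foataHat π).injective (by simpa using hget s.length (by lia))
  refine ⟨⟨s.length + 1, hlen⟩, by rw [hi], ?_⟩
  simpa [eq_comm] using hget (s.length + 1) hlen

theorem foataHat_eq_apply_of_succ {π : Perm (Fin n)} {i j : Fin n} (hj : (j : ℕ) = i + 1)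
    (h : ¬IsCycleMin π (foataHat π j)) : foataHat π j = π (foataHat π i) := by
  obtain ⟨k, hk⟩ := (foataHat π).surjective (π.symm (foataHat π j))
  rw [eq_symm_apply] at hk
  obtain ⟨j', hj', hkj'⟩ := exists_succ_foataHat_eq_apply (hk ▸ h)
  obtain rfl : j' = j := (foataHat π).injective (hkj'.trans hk)
  obtain rfl : k = i := Fin.ext (by lia)
  exact hk.symm

theorem IsCycleMin.apply_le {π : Perm (Fin n)} {a : Fin n} (h : IsCycleMin π (π a)) : π a ≤ a :=
  h a (Perm.sameCycle_apply_left.2 .rfl)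

theorem exists_succ_foataHat_of_lt_apply {π : Perm (Fin n)} {i : Fin n}
    (h : foataHat π i < π (foataHat π i)) :
    ∃ j : Fin n, (j : ℕ) = i + 1 ∧ foataHat π j = π (foataHat π i) :=
  exists_succ_foataHat_eq_apply fun hmin => hmin.apply_le.not_gt h

theorem foataHat_lt_foataHat_succ_iff (π : Perm (Fin n)) {i j : Fin n} (hj : (j : ℕ) = i + 1) :
    foataHat π i < foataHat π j ↔
      foataHat π i < π (foataHat π i) ∧ π (foataHat π i) = foataHat π j := by
  refine ⟨fun hlt => ?_, fun h => h.2 ▸ h.1⟩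
  have hmin : ¬IsCycleMin π (foataHat π j) := by
    rw [← mem_lrMinima_foataHat, mem_lrMinima]
    exact fun h => (h i (by lia)).not_gt hlt
  have heq := foataHat_eq_apply_of_succ hj hmin
  exact ⟨heq ▸ hlt, heq.symm⟩

theorem mem_ascents_foataHat (π : Perm (Fin n)) (i : Fin n) :
    i ∈ ascents (foataHat π) ↔ foataHat π i < π (foataHat π i) := by
  simp only [ascents, Finset.mem_filter, Finset.mem_univ, true_and]
  constructor
  · rintro ⟨j, hj, h⟩
    exact ((foataHat_lt_foataHat_succ_iff π hj).1 h).1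
  · intro h
    obtain ⟨j, hj, hj'⟩ := exists_succ_foataHat_of_lt_apply h
    exact ⟨j, hj, hj' ▸ h⟩

theorem mem_occ123_foataHat (π : Perm (Fin n)) (i : Fin n) :
    i ∈ occ123 (foataHat π) ↔
      foataHat π i < π (foataHat π i) ∧ π (foataHat π i) < π (π (foataHat π i)) := by
  simp only [occ123, Finset.mem_filter, Finset.mem_univ, true_and]
  constructor
  · rintro ⟨j, k, hj, hk, hij, hjk⟩
    rw [foataHat_lt_foataHat_succ_iff π hj] at hij
    rw [foataHat_lt_foataHat_succ_iff π (by lia), ← hij.2] at hjk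
    exact ⟨hij.1, hjk.1⟩
  · rintro ⟨hij, hjk⟩
    obtain ⟨j, hj, hj'⟩ := exists_succ_foataHat_of_lt_apply hij
    rw [← hj'] at hij hjk
    obtain ⟨k, hk, hk'⟩ := exists_succ_foataHat_of_lt_apply hjk
    exact ⟨j, k, hj, by lia, hij, hk' ▸ hjk⟩

theorem excedance_iff_exists_ascent_foataHat (π : Perm (Fin n)) (a b : Fin n) :
    (a < b ∧ π a = b) ↔ ∃ i j : Fin n, i ∈ ascents (foataHat π) ∧
      (j : ℕ) = i + 1 ∧ foataHat π i = a ∧ foataHat π j = b := by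
  constructor
  · rintro ⟨h, rfl⟩
    obtain ⟨i, rfl⟩ := (foataHat π).surjective a
    obtain ⟨j, hj, hj'⟩ := exists_succ_foataHat_of_lt_apply h
    exact ⟨i, j, (mem_ascents_foataHat π i).2 h, hj, rfl, hj'⟩
  · rintro ⟨i, j, hi, hj, rfl, rfl⟩
    simp only [ascents, Finset.mem_filter, Finset.mem_univ, true_and] at hi
    obtain ⟨j', hj', hlt⟩ := hi
    obtain rfl : j' = j := Fin.ext (by lia)
    exact ⟨hlt, ((foataHat_lt_foataHat_succ_iff π hj).1 hlt).2⟩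

theorem doubleExcedance_iff_exists_occ123_foataHat (π : Perm (Fin n)) (a b c : Fin n) :
    (a < b ∧ b < c ∧ π a = b ∧ π b = c) ↔
      ∃ i j k : Fin n, i ∈ occ123 (foataHat π) ∧ (j : ℕ) = i + 1 ∧ (k : ℕ) = i + 2 ∧
        foataHat π i = a ∧ foataHat π j = b ∧ foataHat π k = c := by
  constructor
  · rintro ⟨hab, hbc, rfl, rfl⟩
    obtain ⟨i, rfl⟩ := (foataHat π).surjective a
    obtain ⟨j, hj, hj'⟩ := exists_succ_foataHat_of_lt_apply hab
    obtain ⟨k, hk, hk'⟩ := exists_succ_foataHat_of_lt_apply (hj' ▸ hbc)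
    exact ⟨i, j, k, (mem_occ123_foataHat π i).2 ⟨hab, hbc⟩, hj, by lia, rfl, hj', hj' ▸ hk'⟩
  · rintro ⟨i, j, k, hi, hj, hk, rfl, rfl, rfl⟩
    simp only [occ123, Finset.mem_filter, Finset.mem_univ, true_and] at hi
    obtain ⟨j', k', hj', hk', hij, hjk⟩ := hi
    obtain rfl : j' = j := Fin.ext (by lia)
    obtain rfl : k' = k := Fin.ext (by lia)
    exact ⟨hij, hjk, ((foataHat_lt_foataHat_succ_iff π hj).1 hij).2,
      ((foataHat_lt_foataHat_succ_iff π (by lia)).1 hjk).2⟩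

theorem mem_excedances {π : Perm (Fin n)} {a : Fin n} : a ∈ excedances π ↔ π.symm a < a := by
  obtain ⟨b, rfl⟩ := π.surjective a
  simp [excedances]

theorem mem_doubleExcedances {π : Perm (Fin n)} {a : Fin n} :
    a ∈ doubleExcedances π ↔ π.symm a < a ∧ a < π a := by
  obtain ⟨b, rfl⟩ := π.surjective a
  simp [doubleExcedances]

theorem card_ascents_foataHat (π : Perm (Fin n)) :
    (ascents (foataHat π)).card = (excedances π).card :=
  Finset.card_equiv ((foataHat π).trans π) fun i => by simp [mem_ascents_foataHat, mem_excedances]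

theorem card_occ123_foataHat (π : Perm (Fin n)) :
    (occ123 (foataHat π)).card = (doubleExcedances π).card :=
  Finset.card_equiv ((foataHat π).trans π) fun i => by
    simp [mem_occ123_foataHat, mem_doubleExcedances]

theorem card_lrMinima_foataHat (π : Perm (Fin n)) :
    (lrMinima (foataHat π)).card = cycleCount π := by
  rw [cycleCount_eq_card_filter_isCycleMin]
  exact Finset.card_equiv (foataHat π) fun i => by simp [mem_lrMinima_foataHat]

theorem apply_foataHat_eq_cycleMin {π : Perm (Fin n)} {i : Fin n}
    (h : ∀ j : Fin n, (j : ℕ) = i + 1 → IsCycleMin π (foataHat π j)) :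
    π (foataHat π i) = cycleMin π (foataHat π i) := by
  have hmin : IsCycleMin π (π (foataHat π i)) := by
    by_contra hmin
    obtain ⟨j, hj, hj'⟩ := exists_succ_foataHat_eq_apply hmin
    exact hmin (hj' ▸ h j hj)
  rw [← cycleMin_apply, isCycleMin_iff.1 hmin]

theorem foataHat_injective : Function.Injective (foataHat : Perm (Fin n) → Perm (Fin n)) := by
  intro π σ h
  have hmin (j : Fin n) : IsCycleMin π (foataHat π j) ↔ IsCycleMin σ (foataHat σ j) := by
    rw [← mem_lrMinima_foataHat, h, mem_lrMinima_foataHat]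
  ext1 a
  obtain ⟨i, rfl⟩ := (foataHat π).surjective a
  by_cases hi : ∀ j : Fin n, (j : ℕ) = i + 1 → IsCycleMin π (foataHat π j)
  · rw [apply_foataHat_eq_cycleMin hi, h,
      apply_foataHat_eq_cycleMin fun j hj => (hmin j).1 (hi j hj)]
    exact (h ▸ isLeast_image_foataHat_Iic π i).unique (isLeast_image_foataHat_Iic σ i)
  · push Not at hi
    obtain ⟨j, hj, hj'⟩ := hi
    rw [← foataHat_eq_apply_of_succ hj hj', h, foataHat_eq_apply_of_succ hj ((hmin j).not.1 hj')]

theorem foataHat_bijective : Function.Bijective (foataHat : Perm (Fin n) → Perm (Fin n)) :=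
  Finite.injective_iff_bijective.1 foataHat_injective

end PermStat

namespace JFrac

open PowerSeries

variable {R : Type*} [CommRing R]

theorem mul_convergentFrom_succ (d l : ℕ → R) (h N : ℕ) :
    (1 - C (l h) * X - C (d (h + 1)) * X ^ 2 * convergentFrom d l (h + 1) N) *
      convergentFrom d l h (N + 1) = 1 :=
  mul_invOfUnit _ _ (by simp)

/-- By `hS` and `hG`, the quotient `G h / S h` unfolds into the continued fraction from level `h`.
The denominator is cleared because `S (h + 1)` is a multiple of `X` and need not be regular. -/
theorem X_pow_dvd_sub_convergentFrom_mul {d l a b : ℕ → R} {G S : ℕ → R⟦X⟧}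
    (hS : ∀ h, S (h + 1) = C (a h) * X * G h)
    (hG : ∀ h, G h = S h + C (l h) * X * G h + C (b h) * X * G (h + 1))
    (hd : ∀ h, d (h + 1) = a h * b h) (N h : ℕ) :
    X ^ N ∣ G h - convergentFrom d l h N * S h := by
  induction N generalizing h with
  | zero => simp
  | succ N ih =>
    obtain ⟨E, hE⟩ := ih (h + 1)
    rw [hS, sub_eq_iff_eq_add] at hE
    have hconv := mul_convergentFrom_succ d l h N
    rw [hd, map_mul] at hconv
    have hGh := hG h
    rw [hE] at hGh
    refine ⟨convergentFrom d l h (N + 1) * C (b h) * E, ?_⟩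
    linear_combination convergentFrom d l h (N + 1) * hGh - G h * hconv

theorem isJFraction_of_tridiagonal_recurrence {d l a b : ℕ → R} {p : ℕ → ℕ → R}
    (h00 : p 0 0 = 1) (h0 : ∀ h, p 0 (h + 1) = 0)
    (hz : ∀ m, p (m + 1) 0 = l 0 * p m 0 + b 0 * p m 1)
    (hs : ∀ m h, p (m + 1) (h + 1) =
      a h * p m h + l (h + 1) * p m (h + 1) + b (h + 1) * p m (h + 2))
    (hd : ∀ h, d (h + 1) = a h * b h) :
    IsJFraction (mk fun m => p m 0) d l := by
  let G : ℕ → R⟦X⟧ := fun h => mk fun m => p m h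
  let S : ℕ → R⟦X⟧
    | 0 => 1
    | h + 1 => C (a h) * X * G h
  have hG (h : ℕ) : G h = S h + C (l h) * X * G h + C (b h) * X * G (h + 1) := by
    ext m
    cases h <;> cases m <;>
      simp [G, S, mul_assoc, coeff_succ_X_mul, h00, h0, hz, hs, coeff_one]
  intro m
  filter_upwards [Filter.eventually_gt_atTop m] with N hN
  have hdvd := X_pow_dvd_sub_convergentFrom_mul (fun _ => rfl) hG hd N 0
  have hcoeff := X_pow_dvd_iff.1 hdvd m hN
  rw [map_sub, sub_eq_zero] at hcoeff
  simpa [S, G] using hcoeff.symm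

end JFrac

namespace PermStat

open Equiv

variable {n : ℕ}

/-- Insertion of a new largest element into the cycles of `τ`: as a fixed point (`none`), or
immediately before `x` in its cycle (`some x`). -/
def insertLast : Option (Fin n) × Perm (Fin n) ≃ Perm (Fin (n + 1)) :=
  Perm.decomposeOption.symm.trans (permCongr finSuccEquivLast.symm)

theorem insertLast_none_castSucc (τ : Perm (Fin n)) (i : Fin n) :
    insertLast (none, τ) i.castSucc = (τ i).castSucc := by
  simp [insertLast, permCongr_apply]

theorem insertLast_none_last (τ : Perm (Fin n)) :
    insertLast (none, τ) (Fin.last n) = Fin.last n := by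
  simp [insertLast, permCongr_apply]

theorem insertLast_some_castSucc (τ : Perm (Fin n)) (x i : Fin n) :
    insertLast (some x, τ) i.castSucc = if τ i = x then Fin.last n else (τ i).castSucc := by
  split_ifs with h
  · simp [insertLast, permCongr_apply, h]
  · have : swap none (some x) (some (τ i)) = some (τ i) :=
      swap_apply_of_ne_of_ne (by simp) (by simpa using h)
    simp [insertLast, permCongr_apply, this]

theorem insertLast_some_last (τ : Perm (Fin n)) (x : Fin n) :
    insertLast (some x, τ) (Fin.last n) = x.castSucc := by
  simp [insertLast, permCongr_apply]

theorem insertLast_none_symm_castSucc (τ : Perm (Fin n)) (i : Fin n) :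
    (insertLast (none, τ)).symm i.castSucc = (τ.symm i).castSucc := by
  rw [symm_apply_eq, insertLast_none_castSucc, apply_symm_apply]

theorem insertLast_none_symm_last (τ : Perm (Fin n)) :
    (insertLast (none, τ)).symm (Fin.last n) = Fin.last n := by
  rw [symm_apply_eq, insertLast_none_last]

theorem insertLast_some_symm_castSucc (τ : Perm (Fin n)) (x i : Fin n) :
    (insertLast (some x, τ)).symm i.castSucc =
      if i = x then Fin.last n else (τ.symm i).castSucc := by
  rw [symm_apply_eq]
  split_ifs with h
  · rw [insertLast_some_last, h]
  · rw [insertLast_some_castSucc, apply_symm_apply, if_neg h]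

theorem insertLast_some_symm_last (τ : Perm (Fin n)) (x : Fin n) :
    (insertLast (some x, τ)).symm (Fin.last n) = (τ.symm x).castSucc := by
  rw [symm_apply_eq, insertLast_some_castSucc, apply_symm_apply, if_pos rfl]

theorem sameCycle_map {α β : Type*} {σ : Perm α} {τ : Perm β} {f : α → β}
    (hf : ∀ a, τ.SameCycle (f a) (f (σ a))) {a b : α} (h : σ.SameCycle a b) :
    τ.SameCycle (f a) (f b) := by
  obtain ⟨k, rfl⟩ := h
  induction k with
  | zero => exact .rfl
  | succ k ih =>
    rw [add_comm, zpow_one_add, Perm.mul_apply]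
    exact ih.trans (hf _)
  | pred k ih =>
    refine ih.trans (.symm ?_)
    simpa [← Perm.mul_apply, ← zpow_one_add] using hf ((σ ^ (-(k : ℤ) - 1)) a)

theorem sameCycle_insertLast_castSucc_apply (o : Option (Fin n)) (τ : Perm (Fin n)) (i : Fin n) :
    (insertLast (o, τ)).SameCycle i.castSucc (τ i).castSucc := by
  have hstep : (τ i).castSucc = insertLast (o, τ) i.castSucc ∨
      (τ i).castSucc = insertLast (o, τ) (insertLast (o, τ) i.castSucc) := by
    rcases o with _ | x
    · exact .inl (insertLast_none_castSucc τ i).symm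
    · by_cases hx : τ i = x <;> simp [insertLast_some_castSucc, insertLast_some_last, hx]
  rcases hstep with h | h <;> simp [h, Perm.sameCycle_apply_right, Perm.SameCycle.rfl]

theorem sameCycle_of_insertLast {o : Option (Fin n)} {τ : Perm (Fin n)} {i j : Fin n}
    (h : (insertLast (o, τ)).SameCycle i.castSucc j.castSucc) : τ.SameCycle i j := by
  -- The inserted element is contracted into its successor.
  let contract : Fin (n + 1) → Fin n := Fin.lastCases (o.getD i) id
  have hcontract (a : Fin (n + 1)) :
      τ.SameCycle (contract a) (contract (insertLast (o, τ) a)) := by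
    cases a using Fin.lastCases with
    | last =>
      rcases o with _ | x <;>
        simp [contract, insertLast_none_last, insertLast_some_last, Perm.SameCycle.rfl]
    | cast a =>
      rcases o with _ | x
      · simp [contract, insertLast_none_castSucc, Perm.SameCycle.rfl]
      · rw [insertLast_some_castSucc]
        split_ifs with hx
        · simp [contract, ← hx, Perm.SameCycle.rfl]
        · simp [contract, Perm.SameCycle.rfl]
  simpa [contract] using sameCycle_map hcontract h

theorem sameCycle_insertLast_iff {o : Option (Fin n)} {τ : Perm (Fin n)} {i j : Fin n} :
    (insertLast (o, τ)).SameCycle i.castSucc j.castSucc ↔ τ.SameCycle i j :=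
  ⟨sameCycle_of_insertLast, sameCycle_map (sameCycle_insertLast_castSucc_apply o τ)⟩

theorem isCycleMin_insertLast_castSucc (o : Option (Fin n)) (τ : Perm (Fin n)) (i : Fin n) :
    IsCycleMin (insertLast (o, τ)) i.castSucc ↔ IsCycleMin τ i := by
  simp only [IsCycleMin, Fin.forall_fin_succ', sameCycle_insertLast_iff,
    Fin.castSucc_le_castSucc_iff, Fin.le_last, implies_true, and_true]

theorem isCycleMin_insertLast_last (o : Option (Fin n)) (τ : Perm (Fin n)) :
    IsCycleMin (insertLast (o, τ)) (Fin.last n) ↔ o = none := by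
  rcases o with _ | x
  · simp only [iff_true]
    exact fun j hj => (hj.eq_of_left (insertLast_none_last τ)).le
  · simp only [reduceCtorEq, iff_false]
    intro h
    have hle := h _ (Perm.sameCycle_apply_right.2 .rfl)
    rw [insertLast_some_last] at hle
    exact (Fin.castSucc_lt_last x).not_ge hle

theorem cycleCount_insertLast (o : Option (Fin n)) (τ : Perm (Fin n)) :
    cycleCount (insertLast (o, τ)) = cycleCount τ + if o = none then 1 else 0 := by
  simp only [cycleCount_eq_card_filter_isCycleMin, Finset.card_filter, Fin.sum_univ_castSucc,
    isCycleMin_insertLast_castSucc, isCycleMin_insertLast_last]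

theorem derivation_prod {R A M ι : Type*} [CommSemiring R] [CommSemiring A] [Algebra R A]
    [AddCommMonoid M] [Module A M] [Module R M] [DecidableEq ι] (D : Derivation R A M)
    (s : Finset ι) (f : ι → A) :
    D (∏ i ∈ s, f i) = ∑ i ∈ s, (∏ j ∈ s.erase i, f j) • D (f i) := by
  induction s using Finset.induction_on with
  | empty => simp
  | insert a s ha ih =>
    have hterm : ∀ i ∈ s, (∏ j ∈ (insert a s).erase i, f j) • D (f i) =
        f a • (∏ j ∈ s.erase i, f j) • D (f i) := by
      intro i hi
      rw [Finset.erase_insert_of_ne (ne_of_mem_of_not_mem hi ha).symm,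
        Finset.prod_insert fun h => ha (Finset.mem_of_mem_erase h), mul_smul]
    rw [Finset.prod_insert ha, Finset.sum_insert ha, Finset.erase_insert ha,
      Finset.sum_congr rfl hterm, ← Finset.smul_sum, ← ih, D.leibniz, add_comm]

section Weight

variable {R A : Type*} [CommSemiring R] [CommSemiring A] [Algebra R A] (ω : Bool → Bool → A)

/-- The product of the weights `ω p q` of the elements `j` of `π`, where `p` tells whether `j` is
an excedance value and `q` whether `j < π j`. -/
def weight (π : Perm (Fin n)) : A :=
  ∏ j, ω (π.symm j < j) (j < π j)

theorem weight_insertLast_none (τ : Perm (Fin n)) :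
    weight ω (insertLast (none, τ)) = ω false false * weight ω τ := by
  simp [weight, Fin.prod_univ_castSucc, insertLast_none_castSucc, insertLast_none_last,
    insertLast_none_symm_castSucc, insertLast_none_symm_last, mul_comm]

theorem weight_insertLast_some (τ : Perm (Fin n)) (x : Fin n) :
    weight ω (insertLast (some x, τ)) = ω true false *
      ∏ j, ω (j ≠ x ∧ τ.symm j < j) (τ j = x ∨ j < τ j) := by
  simp only [weight, Fin.prod_univ_castSucc, insertLast_some_castSucc, insertLast_some_last,
    insertLast_some_symm_castSucc, insertLast_some_symm_last, mul_comm (ω true false)]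
  congr 1
  · refine Finset.prod_congr rfl fun j _ => ?_
    congr 2
    · split_ifs with h <;> simp [h, Fin.le_last]
    · split_ifs with h <;> simp [h, Fin.castSucc_lt_last]
  · simp [Fin.castSucc_lt_last, (Fin.castSucc_lt_last _).not_gt]

theorem weight_insertLast_some_of_symm_lt {τ : Perm (Fin n)} {x : Fin n} (h : τ.symm x < x) :
    weight ω (insertLast (some x, τ)) = ω true false *
      (ω false (x < τ x) * ∏ j ∈ Finset.univ.erase x, ω (τ.symm j < j) (j < τ j)) := by
  have hasc (j : Fin n) : (τ j = x ∨ j < τ j) ↔ j < τ j := by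
    rw [or_iff_right_iff_imp]
    rintro rfl
    simpa using h
  rw [weight_insertLast_some, ← Finset.mul_prod_erase _ _ (Finset.mem_univ x)]
  simp only [hasc, ne_eq, not_true_eq_false, false_and, decide_false]
  congr 2
  refine Finset.prod_congr rfl fun j hj => ?_
  simp [Finset.ne_of_mem_erase hj]

theorem weight_insertLast_some_of_apply_le {τ : Perm (Fin n)} {y : Fin n} (h : τ y ≤ y) :
    weight ω (insertLast (some (τ y), τ)) = ω true false *
      (ω (τ.symm y < y) true * ∏ j ∈ Finset.univ.erase y, ω (τ.symm j < j) (j < τ j)) := by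
  have hexc (j : Fin n) : (j ≠ τ y ∧ τ.symm j < j) ↔ τ.symm j < j := by
    rw [and_iff_right_iff_imp]
    rintro hj rfl
    rw [symm_apply_apply] at hj
    exact h.not_gt hj
  rw [weight_insertLast_some, ← Finset.mul_prod_erase _ _ (Finset.mem_univ y)]
  simp only [hexc, true_or, decide_true]
  congr 2
  refine Finset.prod_congr rfl fun j hj => ?_
  simp [Finset.ne_of_mem_erase hj]

theorem sum_weight_insertLast_some (τ : Perm (Fin n)) :
    ∑ x, weight ω (insertLast (some x, τ)) = ω true false * ∑ j,
      ((if τ.symm j < j then ω false (j < τ j) else 0) +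
        if j < τ j then 0 else ω (τ.symm j < j) true) *
          ∏ i ∈ Finset.univ.erase j, ω (τ.symm i < i) (i < τ i) := by
  let rest (j : Fin n) : A := ∏ i ∈ Finset.univ.erase j, ω (τ.symm i < i) (i < τ i)
  let above (j : Fin n) : A := if j < τ j then 0 else ω (τ.symm j < j) true * rest j
  have hterm (x : Fin n) : weight ω (insertLast (some x, τ)) = ω true false *
      ((if τ.symm x < x then ω false (x < τ x) * rest x else 0) + above (τ.symm x)) := by
    by_cases h : τ.symm x < x
    · simp [weight_insertLast_some_of_symm_lt ω h, h, rest, above]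
    · have h' : τ (τ.symm x) ≤ τ.symm x := by simpa using h
      simpa [h, rest, above] using weight_insertLast_some_of_apply_le ω h'
  simp only [hterm, ← Finset.mul_sum, Finset.sum_add_distrib, τ.symm.sum_comp above]
  simp only [← Finset.sum_add_distrib, above, rest, add_mul, ite_mul, zero_mul]

theorem sum_weight_insertLast_some_eq_derivation {ω : Bool → Bool → A} {D : Derivation R A A}
    (hD : ∀ p q, D (ω p q) =
      ω true false * ((if p then ω false q else 0) + if q then 0 else ω p true))
    (τ : Perm (Fin n)) :
    ∑ x, weight ω (insertLast (some x, τ)) = D (weight ω τ) := by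
  rw [sum_weight_insertLast_some, weight, derivation_prod]
  simp only [hD, Finset.mul_sum, smul_eq_mul, mul_comm (∏ _ ∈ _, _), mul_assoc,
    decide_eq_true_eq]

/-- The sum of `t ^ cyc(π)` times the weight of `π` over the permutations `π` of `Fin n`. -/
noncomputable def cycleEnumerator (t : R) (n : ℕ) : A :=
  ∑ π : Perm (Fin n), t ^ cycleCount π • weight ω π

theorem cycleEnumerator_zero (t : R) : cycleEnumerator ω t 0 = 1 := by
  simp [cycleEnumerator, weight, cycleCount_eq_card_filter_isCycleMin]

theorem cycleEnumerator_succ {ω : Bool → Bool → A} {D : Derivation R A A}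
    (hD : ∀ p q, D (ω p q) =
      ω true false * ((if p then ω false q else 0) + if q then 0 else ω p true))
    (t : R) (n : ℕ) :
    cycleEnumerator ω t (n + 1) =
      t • (ω false false * cycleEnumerator ω t n) + D (cycleEnumerator ω t n) := by
  rw [cycleEnumerator, ← insertLast.sum_comp, Fintype.sum_prod_type, Fintype.sum_option]
  simp only [cycleCount_insertLast, weight_insertLast_none, reduceCtorEq, if_true, if_false,
    add_zero]
  congr 1
  · simp only [cycleEnumerator, Finset.mul_sum, Finset.smul_sum, mul_smul_comm, smul_smul,
      pow_succ']
  · rw [Finset.sum_comm]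
    simp only [← Finset.smul_sum, sum_weight_insertLast_some_eq_derivation hD, cycleEnumerator,
      map_sum, D.map_smul]

theorem weight_excedances (v w : A) (π : Perm (Fin n)) :
    weight (fun p q => (if p then v else 1) * if p && q then w else 1) π =
      v ^ (excedances π).card * w ^ (doubleExcedances π).card := by
  have hexc : excedances π = Finset.univ.filter fun j => π.symm j < j := by
    ext j; simp [mem_excedances]
  have hdexc : doubleExcedances π = Finset.univ.filter fun j => π.symm j < j ∧ j < π j := by
    ext j; simp [mem_doubleExcedances]
  rw [hexc, hdexc, weight, ← Finset.prod_const, ← Finset.prod_const, Finset.prod_filter,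
    Finset.prod_filter, ← Finset.prod_mul_distrib]
  simp only [Bool.and_eq_true, decide_eq_true_eq]

theorem map_weight {B : Type*} [CommSemiring B] (f : A →+* B) (π : Perm (Fin n)) :
    f (weight ω π) = weight (fun p q => f (ω p q)) π :=
  map_prod f _ _

end Weight

section Polynomial

open Polynomial

variable {R : Type*} [CommRing R] (v w t : R)

/-- The polynomial local weights for `weight`. The variable `X` marks the arcs `i ↦ π i` that are
cut open because elements larger than the present ones are still to be inserted there; an arc is
recorded at its larger endpoint, a loop at its only one. A cut arc counts as if its far end were a
larger element, so that, for instance, a cut arc into a peak turns it into a double descent and a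
cut arc out of it into a double excedance. -/
noncomputable def arcWeight (v w : R) : Bool → Bool → R[X]
  | true, true => C (v * w) + X
  | true, false => C v + C (1 + v * w) * X + X ^ 2
  | false, true => 1
  | false, false => 1 + X

theorem mkDerivation_arcWeight (p q : Bool) :
    mkDerivation R (arcWeight v w true false) (arcWeight v w p q) = arcWeight v w true false *
      ((if p then arcWeight v w false q else 0) + if q then 0 else arcWeight v w p true) := by
  rw [mkDerivation_apply, smul_eq_mul, mul_comm]
  congr 1
  cases p <;> cases q <;> simp [arcWeight]
  ring

theorem coeff_zero_arcWeight (p q : Bool) :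
    (arcWeight v w p q).coeff 0 = (if p then v else 1) * if p && q then w else 1 := by
  cases p <;> cases q <;> simp [arcWeight]

theorem cycleEnumerator_arcWeight_succ (n : ℕ) :
    cycleEnumerator (arcWeight v w) t (n + 1) =
      C t * (1 + X) * cycleEnumerator (arcWeight v w) t n +
        (C v + C (1 + v * w) * X + X ^ 2) * derivative (cycleEnumerator (arcWeight v w) t n) := by
  rw [cycleEnumerator_succ (mkDerivation_arcWeight v w), mkDerivation_apply]
  simp only [arcWeight, smul_eq_C_mul, smul_eq_mul]
  ring

theorem coeff_zero_cycleEnumerator_succ (n : ℕ) :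
    (cycleEnumerator (arcWeight v w) t (n + 1)).coeff 0 =
      t * (cycleEnumerator (arcWeight v w) t n).coeff 0 +
        v * (cycleEnumerator (arcWeight v w) t n).coeff 1 := by
  rw [cycleEnumerator_arcWeight_succ]
  simp [mul_coeff_zero, coeff_derivative]

theorem coeff_succ_cycleEnumerator_succ (n h : ℕ) :
    (cycleEnumerator (arcWeight v w) t (n + 1)).coeff (h + 1) =
      (h + t) * (cycleEnumerator (arcWeight v w) t n).coeff h +
        (t + (h + 1) * (1 + v * w)) * (cycleEnumerator (arcWeight v w) t n).coeff (h + 1) +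
        v * (h + 2) * (cycleEnumerator (arcWeight v w) t n).coeff (h + 2) := by
  set P := cycleEnumerator (arcWeight v w) t n
  have hsucc : cycleEnumerator (arcWeight v w) t (n + 1) = C t * P + C t * (X * P) +
      C v * derivative P + C (1 + v * w) * (X * derivative P) + X * (X * derivative P) := by
    rw [cycleEnumerator_arcWeight_succ]
    ring
  rw [hsucc]
  simp only [coeff_add, coeff_C_mul, coeff_X_mul, coeff_derivative]
  cases h with
  | zero =>
    simp only [coeff_X_mul_zero]
    push_cast
    ring
  | succ h =>
    simp only [coeff_X_mul, coeff_derivative]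
    push_cast
    ring

theorem coeff_zero_cycleEnumerator (n : ℕ) :
    (cycleEnumerator (arcWeight v w) t n).coeff 0 = ∑ π : Perm (Fin n),
      v ^ (ascents π).card * w ^ (occ123 π).card * t ^ (lrMinima π).card := by
  have hcoeff (π : Perm (Fin n)) : (weight (arcWeight v w) π).coeff 0 =
      v ^ (excedances π).card * w ^ (doubleExcedances π).card := by
    rw [← weight_excedances, ← constantCoeff_apply, map_weight]
    simp only [constantCoeff_apply, coeff_zero_arcWeight]
  rw [← (Equiv.ofBijective _ (foataHat_bijective (n := n))).sum_comp]
  simp [cycleEnumerator, hcoeff, card_ascents_foataHat, card_occ123_foataHat,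
    card_lrMinima_foataHat, finsetSum_coeff, mul_comm]

theorem isJFraction_ascents_occ123_lrMinima :
    JFrac.IsJFraction
      (PowerSeries.mk fun n => ∑ π : Perm (Fin n),
        v ^ (ascents π).card * w ^ (occ123 π).card * t ^ (lrMinima π).card)
      (fun h => v * (h : R) * ((h : R) - 1 + t)) (fun h => t + (h : R) * (1 + v * w)) := by
  simp only [← coeff_zero_cycleEnumerator]
  refine JFrac.isJFraction_of_tridiagonal_recurrence
    (p := fun m h => (cycleEnumerator (arcWeight v w) t m).coeff h)
    (a := fun h => h + t) (b := fun h => v * (h + 1)) ?_ ?_ ?_ ?_ ?_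
  · simp [cycleEnumerator_zero]
  · simp [cycleEnumerator_zero, coeff_one]
  · intro m
    simp [coeff_zero_cycleEnumerator_succ]
  · intro m h
    rw [coeff_succ_cycleEnumerator_succ]
    push_cast
    ring
  · intro h
    push_cast
    ring

theorem isJFraction_occ123 :
    JFrac.IsJFraction (PowerSeries.mk fun n => ∑ π : Perm (Fin n), w ^ (occ123 π).card)
      (fun h => (h : R) ^ 2) (fun h => ((h : R) + 1) + (h : R) * w) := by
  convert isJFraction_ascents_occ123_lrMinima 1 w 1 using 1
  · simp
  · ext h; ring
  · ext h; ring

end Polynomial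

end PermStat

theorem mainTheorem4 {R : Type*} [CommRing R] (v w t : R) :
    -- the generating function by occurrences of consecutive 123
    JFrac.IsJFraction
      (PowerSeries.mk fun n => ∑ π : Equiv.Perm (Fin n), w ^ (PermStat.occ123 π).card)
      (fun h => (h : R) ^ 2) (fun h => ((h : R) + 1) + (h : R) * w) ∧
    -- its refinement by ascents and left-to-right minima
    JFrac.IsJFraction
      (PowerSeries.mk fun n => ∑ π : Equiv.Perm (Fin n),
        v ^ (PermStat.ascents π).card * w ^ (PermStat.occ123 π).card *
          t ^ (PermStat.lrMinima π).card)
      (fun h => v * (h : R) * ((h : R) - 1 + t)) (fun h => t + (h : R) * (1 + v * w)) ∧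
    -- the map `π ↦ π̂` is a bijection
    (∀ n : ℕ, Function.Bijective (PermStat.foataHat : Equiv.Perm (Fin n) → Equiv.Perm (Fin n))) ∧
    ∀ (n : ℕ) (π : Equiv.Perm (Fin n)),
      -- it sends double excedances to occurrences of consecutive 123 ...
      (∀ a b c : Fin n,
        (a < b ∧ b < c ∧ π a = b ∧ π b = c) ↔
          ∃ i j k : Fin n, i ∈ PermStat.occ123 (PermStat.foataHat π) ∧
            (j : ℕ) = i + 1 ∧ (k : ℕ) = i + 2 ∧ PermStat.foataHat π i = a ∧
            PermStat.foataHat π j = b ∧ PermStat.foataHat π k = c) ∧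
      (PermStat.occ123 (PermStat.foataHat π)).card = (PermStat.doubleExcedances π).card ∧
      -- ... excedances to ascents ...
      (∀ a b : Fin n,
        (a < b ∧ π a = b) ↔
          ∃ i j : Fin n, i ∈ PermStat.ascents (PermStat.foataHat π) ∧
            (j : ℕ) = i + 1 ∧ PermStat.foataHat π i = a ∧ PermStat.foataHat π j = b) ∧
      (PermStat.ascents (PermStat.foataHat π)).card = (PermStat.excedances π).card ∧
      -- ... and cycles, through their smallest elements, to left-to-right minima
      (∀ i : Fin n, i ∈ PermStat.lrMinima (PermStat.foataHat π) ↔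
        PermStat.IsCycleMin π (PermStat.foataHat π i)) ∧
      (PermStat.lrMinima (PermStat.foataHat π)).card = PermStat.cycleCount π := by
  exact ⟨PermStat.isJFraction_occ123 w, PermStat.isJFraction_ascents_occ123_lrMinima v w t,
    fun _ => PermStat.foataHat_bijective, fun _ π =>
      ⟨PermStat.doubleExcedance_iff_exists_occ123_foataHat π, PermStat.card_occ123_foataHat π,
        PermStat.excedance_iff_exists_ascent_foataHat π, PermStat.card_ascents_foataHat π,
        PermStat.mem_lrMinima_foataHat π, PermStat.card_lrMinima_foataHat π⟩⟩
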